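/- Notation. Let $m,n,L\ge 0$ be integers and $r\ge 1$ an integer. For $x\in\mathbb{R}^k$ put $\|x\|_q=(\sum_j|x_j|^q)^{1/q}$ for $0<q<\infty$ and $\|x\|_\infty=\max_j|x_j|$. For $X\in\mathbb{R}^{m\times n}$ with singular values $\sigma(X)=(\sigma_1\ge\dots\ge\sigma_{\min\{m,n\}})$ let $\|X\|_{S_t}=\|\sigma(X)\|_t$, $0<t\le\infty$, be the Schatten (quasi-)norm. Let $X_{\max(r)}$ denote a (fixed choice of) best approximation of $X$ in the Frobenius norm among matrices of rank at most $r$, and $X_{-\max(r)}=X-X_{\max(r)}$. For a linear map $\mathcal{A}:\mathbb{R}^{m\times n}\to\mathbb{R}^L$ let $\mathcal{A}^*$ be its adjoint for the standard inner products. We set $1/\infty=0$. Let $0<p\le 1$ and $p\le t\le\infty$, and let $0<q<\infty$. We say that $\mathcal{A}$ satisfies the $(\ell_t,\ell_p)$-robust rank null space property of order $r$ with constants $D$ and $\beta$, for the $\ell_q$ bound, respectively for the Dantzig selector bound, if for all $X\in\mathbb{R}^{m\times n}$ $$\|X_{\max(r)}\|_{S_t}^p\le D\|\mathcal{A}(X)\|_q^p+\beta\,\frac{\|X_{-\max(r)}\|_{S_p}^p}{r^{(1/p-1/t)p}},$$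 respectively $$\|X_{\max(r)}\|_{S_t}^p\le D\|\mathcal{A}^*\mathcal{A}(X)\|_{S_\infty}^p+\beta\,\frac{\|X_{-\max(r)}\|_{S_p}^p}{r^{(1/p-1/t)p}}.$$ Theorem. (1) If $\mathcal{A}$ satisfies the $(\ell_t,\ell_p)$-robust rank null space property of order $r$ for the $\ell_q$ bound with constants $D>0$ and $0<\beta<1$, then for all $X,Y\in\mathbb{R}^{m\times n}$ $$\|Y-X\|_{S_t}^p\le\frac{(1+\beta)^2}{1-\beta}\,\frac{1}{r^{(1/p-1/t)p}}\Big(\|Y\|_{S_p}^p-\|X\|_{S_p}^p+2\|X_{-\max(r)}\|_{S_p}^p\Big)+\frac{(3+\beta)D}{1-\beta}\,\|\mathcal{A}(Y-X)\|_q^p.$$ (2) If $\mathcal{A}$ satisfies the $(\ell_t,\ell_p)$-robust rank null space property of order $r$ for the Dantzig selector bound with constants $D>0$ and $0<\beta<1$, then for all $X,Y\in\mathbb{R}^{m\times n}$ $$\|Y-X\|_{S_t}^p\le\frac{(1+\beta)^2}{1-\beta}\,\frac{1}{r^{(1/p-1/t)p}}\Big(\|Y\|_{S_p}^p-\|X\|_{S_p}^p+2\|X_{-\max(r)}\|_{S_p}^p\Big)+\frac{(3+\beta)D}{1-\beta}\,\|\mathcal{A}^*\mathcal{A}(Y-X)\|_{S_\infty}^p.$$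 -/

import Mathlib

open scoped ENNReal

namespace RankNSP

noncomputable section

variable {m n L : ℕ}

/-- The `ℓ_q` (quasi-)norm of a finite real vector: `(∑ |x_j| ^ q) ^ (1 / q)` for `0 < q < ∞`
and `max |x_j|` for `q = ∞`. -/
def lNorm {k : ℕ} (q : ℝ≥0∞) (x : Fin k → ℝ) : ℝ :=
  ‖(WithLp.toLp q x : PiLp q (fun _ : Fin k => ℝ))‖

/-- The vector `σ(X) = (σ_1, …, σ_{min (m, n)})` of singular values of a real `m × n` matrix,
in decreasing order. -/
def singularVector (X : Matrix (Fin m) (Fin n) ℝ) : Fin (min m n) → ℝ :=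
  fun j => (Matrix.toEuclideanLin X).singularValues (j : ℕ)

/-- The Schatten (quasi-)norm `‖X‖_{S_t} = ‖σ(X)‖_t`, `0 < t ≤ ∞`. -/
def schattenNorm (t : ℝ≥0∞) (X : Matrix (Fin m) (Fin n) ℝ) : ℝ :=
  lNorm t (singularVector X)

/-- The squared Frobenius norm, `∑ X_{ij} ^ 2`. -/
def frobeniusSq (X : Matrix (Fin m) (Fin n) ℝ) : ℝ :=
  ∑ i, ∑ j, X i j ^ 2

/-- `Z` is a best rank-`r` approximation of `X`: it has rank at most `r` and is nearest to `X`,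
in the Frobenius norm, among all matrices of rank at most `r`. -/
def IsBestRankApprox (r : ℕ) (X Z : Matrix (Fin m) (Fin n) ℝ) : Prop :=
  Z.rank ≤ r ∧ ∀ W : Matrix (Fin m) (Fin n) ℝ, W.rank ≤ r →
    frobeniusSq (X - Z) ≤ frobeniusSq (X - W)

/-- Every matrix has a best rank-`r` approximation. -/
theorem exists_isBestRankApprox (r : ℕ) (X : Matrix (Fin m) (Fin n) ℝ) :
    ∃ Z, IsBestRankApprox r X Z := by
  let M : EuclideanSpace ℝ (Fin m × Fin n) →ₗ[ℝ] Matrix (Fin m) (Fin n) ℝ :=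
    { toFun := fun w => Matrix.of fun i j => w (i, j)
      map_add' := fun _ _ => rfl
      map_smul' := fun _ _ => rfl }
  let T : EuclideanSpace ℝ (Fin m × Fin n) →ₗ[ℝ] ((Fin n → ℝ) →L[ℝ] (Fin m → ℝ)) :=
    (LinearMap.toContinuousLinearMap.toLinearMap ∘ₗ (Matrix.toLin' (R := ℝ)).toLinearMap) ∘ₗ M
  have hT : Continuous T := T.continuous_of_finiteDimensional
  have hrank : ∀ w, ((r + 1 : ℕ) : Cardinal) ≤ (T w : (Fin n → ℝ) →ₗ[ℝ] (Fin m → ℝ)).rank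
      ↔ r + 1 ≤ (M w).rank := by
    intro w
    have h : (T w : (Fin n → ℝ) →ₗ[ℝ] (Fin m → ℝ)) = (M w).mulVecLin := rfl
    rw [h, LinearMap.rank, Matrix.rank, ← Module.finrank_eq_rank, Nat.cast_le]
  have hcl : IsClosed {w | (M w).rank ≤ r} := by
    have ho := (isOpen_setOfPred_nat_le_rank (𝕜 := ℝ) (E := Fin n → ℝ) (F := Fin m → ℝ)
      (r + 1)).preimage hT
    rw [← isOpen_compl_iff]
    convert ho using 1
    ext w
    have := hrank w
    simp only [Set.mem_compl_iff, Set.mem_ofPred_eq, Set.mem_preimage]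
    rw [this]
    omega
  have hne : {w | (M w).rank ≤ r}.Nonempty := ⟨0, by simp⟩
  let x : EuclideanSpace ℝ (Fin m × Fin n) := WithLp.toLp 2 fun ij => X ij.1 ij.2
  obtain ⟨z, hz, hzx⟩ := hcl.exists_infDist_eq_dist hne x
  have hdist : ∀ w, frobeniusSq (X - M w) = dist x w ^ 2 := by
    intro w
    rw [EuclideanSpace.dist_eq, Real.sq_sqrt (Finset.sum_nonneg fun _ _ => sq_nonneg _),
      Fintype.sum_prod_type]
    have hM : ∀ i j, M w i j = w (i, j) := fun _ _ => rfl
    simp only [frobeniusSq, Matrix.sub_apply, hM, Real.dist_eq, sq_abs, x]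
  refine ⟨M z, hz, fun W hW => ?_⟩
  let w : EuclideanSpace ℝ (Fin m × Fin n) := WithLp.toLp 2 fun ij => W ij.1 ij.2
  have hw : M w = W := rfl
  have hle : dist x z ≤ dist x w := by
    rw [← hzx]
    exact Metric.infDist_le_dist_of_mem (by simpa [hw] using hW)
  rw [← hw, hdist, hdist]
  exact pow_le_pow_left₀ dist_nonneg hle 2

/-- `X_{max(r)}`, the best rank-`r` approximation of `X`. -/
def maxPart (r : ℕ) (X : Matrix (Fin m) (Fin n) ℝ) : Matrix (Fin m) (Fin n) ℝ :=
  Classical.choose (exists_isBestRankApprox r X)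

theorem isBestRankApprox_maxPart (r : ℕ) (X : Matrix (Fin m) (Fin n) ℝ) :
    IsBestRankApprox r X (maxPart r X) :=
  Classical.choose_spec (exists_isBestRankApprox r X)

/-- `X_{-max(r)} = X - X_{max(r)}`. -/
def tailPart (r : ℕ) (X : Matrix (Fin m) (Fin n) ℝ) : Matrix (Fin m) (Fin n) ℝ :=
  X - maxPart r X

/-- The adjoint of `A` for the standard inner products `∑ X_{ij} Y_{ij}` and `∑ x_l y_l`. -/
def adjointMap (A : Matrix (Fin m) (Fin n) ℝ →ₗ[ℝ] (Fin L → ℝ)) (b : Fin L → ℝ) :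
    Matrix (Fin m) (Fin n) ℝ :=
  Matrix.of fun i j => ∑ l, b l * A (Matrix.single i j 1) l

/-- The defining property of the adjoint. -/
theorem adjointMap_spec (A : Matrix (Fin m) (Fin n) ℝ →ₗ[ℝ] (Fin L → ℝ))
    (X : Matrix (Fin m) (Fin n) ℝ) (b : Fin L → ℝ) :
    ∑ l, A X l * b l = ∑ i, ∑ j, X i j * adjointMap A b i j := by
  have hX : A X = ∑ i, ∑ j, X i j • A (Matrix.single i j 1) := by
    conv_lhs => rw [Matrix.matrix_eq_sum_single X]
    simp only [map_sum]
    refine Finset.sum_congr rfl fun i _ => Finset.sum_congr rfl fun j _ => ?_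
    rw [← map_smul, Matrix.smul_single, smul_eq_mul, mul_one]
  simp only [hX, Finset.sum_apply, Pi.smul_apply, smul_eq_mul, adjointMap, Matrix.of_apply,
    Finset.sum_mul, Finset.mul_sum]
  rw [Finset.sum_comm]
  refine Finset.sum_congr rfl fun i _ => ?_
  rw [Finset.sum_comm]
  refine Finset.sum_congr rfl fun j _ => Finset.sum_congr rfl fun l _ => ?_
  ring

/-- The factor `r ^ ((1 / p - 1 / t) p)`, where `1 / ∞ = 0`. -/
def rankFactor (r : ℕ) (p : ℝ) (t : ℝ≥0∞) : ℝ :=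
  (r : ℝ) ^ ((1 / p - (t⁻¹).toReal) * p)

/-- The `(ℓ_t, ℓ_p)`-robust rank null space property of order `r` for the `ℓ_q` bound, with
constants `D` and `β`. -/
def RobustRankNSPlq (A : Matrix (Fin m) (Fin n) ℝ →ₗ[ℝ] (Fin L → ℝ)) (t : ℝ≥0∞) (p q : ℝ)
    (r : ℕ) (D β : ℝ) : Prop :=
  ∀ X : Matrix (Fin m) (Fin n) ℝ,
    schattenNorm t (maxPart r X) ^ p ≤
      D * lNorm (ENNReal.ofReal q) (A X) ^ p +
        β * (schattenNorm (ENNReal.ofReal p) (tailPart r X) ^ p / rankFactor r p t)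

/-- The `(ℓ_t, ℓ_p)`-robust rank null space property of order `r` for the Dantzig selector bound,
with constants `D` and `β`. -/
def RobustRankNSPDantzig (A : Matrix (Fin m) (Fin n) ℝ →ₗ[ℝ] (Fin L → ℝ)) (t : ℝ≥0∞) (p : ℝ)
    (r : ℕ) (D β : ℝ) : Prop :=
  ∀ X : Matrix (Fin m) (Fin n) ℝ,
    schattenNorm t (maxPart r X) ^ p ≤
      D * schattenNorm ∞ (adjointMap A (A X)) ^ p +
        β * (schattenNorm (ENNReal.ofReal p) (tailPart r X) ^ p / rankFactor r p t)

end

end RankNSP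

/-! Write K = min(m, n), and let x, z be the singular values of X and Y - X. The engine is the
concave Mirsky inequality `sum_abs_rpow_singularValues_sub_le`: for 0 < p ≤ 1, ∑ |σ_i(A)^p -
σ_i(B)^p| ≤ ∑ σ_i(A - B)^p. Applied to X and X - Y, whose difference is Y, and split at index r, it
bounds the tail of z by its head plus ‖Y‖^p - ‖X‖^p + 2‖X_tail‖^p, all in Schatten-p. Hölder and the
null space property at Y - X bound the head by the measurement term plus β times the tail. As β < 1,
the tail can be absorbed, and Stechkin's estimate passes from p to t.

Mirsky's inequality is proved by adding A - B to B one rank-one piece at a time along right singular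
vectors. For one such step, the case p = 1 comes from the self-adjoint dilation, whose extreme
eigenvalues are ± the singular values, and from comparing traces; the case p < 1 follows from
interlacing and concavity.

Since the best approximation is an arbitrary choice, `singularValues_of_best` and
`singularValues_sub_of_best` show that its singular values, and those of the residual, do not depend
on that choice. -/

namespace RankNSP

open Module InnerProductSpace

/-! ### Courant-Fischer principle for symmetric operators -/

section MinMax

variable {G : Type*} [NormedAddCommGroup G] [InnerProductSpace ℝ G]

/-- The quadratic form of `S` on the span of orthonormal eigenvectors. -/
theorem exists_inner_eq_sum_of_mem_span {ι : Type*} [Fintype ι] {S : G →ₗ[ℝ] G} {f : ι → G}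
    (hf : Orthonormal ℝ f) {μ : ι → ℝ} (hS : ∀ j, S (f j) = μ j • f j) {x : G}
    (hx : x ∈ Submodule.span ℝ (Set.range f)) :
    ∃ a : ι → ℝ, inner ℝ (S x) x = ∑ j, μ j * a j ^ 2 ∧ ‖x‖ ^ 2 = ∑ j, a j ^ 2 := by
  obtain ⟨a, rfl⟩ := (Submodule.mem_span_range_iff_exists_fun ℝ).1 hx
  refine ⟨a, ?_, ?_⟩
  · have : S (∑ j, a j • f j) = ∑ j, (μ j * a j) • f j := by
      simp [map_sum, hS, smul_smul, mul_comm]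
    rw [this, hf.inner_sum]
    exact Finset.sum_congr rfl fun j _ => by simp; ring
  · rw [← real_inner_self_eq_norm_sq, hf.inner_sum]
    exact Finset.sum_congr rfl fun j _ => by simp; ring

theorem le_inner_of_mem_span {ι : Type*} [Fintype ι] {S : G →ₗ[ℝ] G} {f : ι → G}
    (hf : Orthonormal ℝ f) {μ : ι → ℝ} (hS : ∀ j, S (f j) = μ j • f j) {c : ℝ} (hc : ∀ j, c ≤ μ j)
    {x : G} (hx : x ∈ Submodule.span ℝ (Set.range f)) : c * ‖x‖ ^ 2 ≤ inner ℝ (S x) x := by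
  obtain ⟨a, h1, h2⟩ := exists_inner_eq_sum_of_mem_span hf hS hx
  rw [h1, h2, Finset.mul_sum]
  exact Finset.sum_le_sum fun j _ => mul_le_mul_of_nonneg_right (hc j) (sq_nonneg _)

theorem inner_le_of_mem_span {ι : Type*} [Fintype ι] {S : G →ₗ[ℝ] G} {f : ι → G}
    (hf : Orthonormal ℝ f) {μ : ι → ℝ} (hS : ∀ j, S (f j) = μ j • f j) {c : ℝ} (hc : ∀ j, μ j ≤ c)
    {x : G} (hx : x ∈ Submodule.span ℝ (Set.range f)) : inner ℝ (S x) x ≤ c * ‖x‖ ^ 2 := by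
  obtain ⟨a, h1, h2⟩ := exists_inner_eq_sum_of_mem_span hf hS hx
  rw [h1, h2, Finset.mul_sum]
  exact Finset.sum_le_sum fun j _ => mul_le_mul_of_nonneg_right (hc j) (sq_nonneg _)

variable [FiniteDimensional ℝ G]

/-- Two subspaces whose dimensions add up to more than the dimension of the space share a
nonzero vector. -/
theorem exists_mem_mem_ne_zero {U W : Submodule ℝ G} (h : finrank ℝ G < finrank ℝ U + finrank ℝ W) :
    ∃ x ∈ U, x ∈ W ∧ x ≠ 0 := by
  have h1 := Submodule.finrank_sup_add_finrank_inf_eq U W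
  have h2 := Submodule.finrank_le (U ⊔ W)
  have h3 : U ⊓ W ≠ ⊥ := by
    intro h0
    rw [h0, finrank_bot] at h1
    omega
  obtain ⟨x, hx, hx0⟩ := Submodule.exists_mem_ne_zero_of_ne_bot h3
  exact ⟨x, hx.1, hx.2, hx0⟩

variable {S : G →ₗ[ℝ] G} {N : ℕ}

theorem exists_submodule_eigenvalues_le (hS : S.IsSymmetric) (hN : finrank ℝ G = N) (i : Fin N) :
    ∃ W : Submodule ℝ G, finrank ℝ W = i + 1 ∧
      ∀ x ∈ W, hS.eigenvalues hN i * ‖x‖ ^ 2 ≤ inner ℝ (S x) x := by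
  let f : {j : Fin N // j ≤ i} → G := fun j => hS.eigenvectorBasis hN j
  have hf : Orthonormal ℝ f :=
    (hS.eigenvectorBasis hN).orthonormal.comp _ Subtype.val_injective
  refine ⟨Submodule.span ℝ (Set.range f), ?_, fun x hx => ?_⟩
  · rw [finrank_span_eq_card hf.linearIndependent, Fintype.card_subtype,
      Finset.filter_ge_eq_Iic, Fin.card_Iic]
  · exact le_inner_of_mem_span hf (μ := fun j => hS.eigenvalues hN j)
      (fun j => hS.apply_eigenvectorBasis hN j) (fun j => hS.eigenvalues_antitone hN j.2) hx

theorem exists_submodule_le_eigenvalues (hS : S.IsSymmetric) (hN : finrank ℝ G = N) (i : Fin N) :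
    ∃ W : Submodule ℝ G, finrank ℝ W + i = N ∧
      ∀ x ∈ W, inner ℝ (S x) x ≤ hS.eigenvalues hN i * ‖x‖ ^ 2 := by
  let f : {j : Fin N // i ≤ j} → G := fun j => hS.eigenvectorBasis hN j
  have hf : Orthonormal ℝ f :=
    (hS.eigenvectorBasis hN).orthonormal.comp _ Subtype.val_injective
  refine ⟨Submodule.span ℝ (Set.range f), ?_, fun x hx => ?_⟩
  · rw [finrank_span_eq_card hf.linearIndependent, Fintype.card_subtype,
      Finset.filter_le_eq_Ici, Fin.card_Ici]
    omega
  · exact inner_le_of_mem_span hf (μ := fun j => hS.eigenvalues hN j)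
      (fun j => hS.apply_eigenvectorBasis hN j) (fun j => hS.eigenvalues_antitone hN j.2) hx

/-- The eigenvectors of index at least `i` span a space of dimension `N - i`, which must meet `W`
outside zero; the two bounds on the quadratic form are compared at a common vector. -/
theorem le_eigenvalues_of_submodule (hS : S.IsSymmetric) (hN : finrank ℝ G = N) (i : Fin N)
    {W : Submodule ℝ G} (hW : (i : ℕ) < finrank ℝ W) {c : ℝ}
    (h : ∀ x ∈ W, c * ‖x‖ ^ 2 ≤ inner ℝ (S x) x) : c ≤ hS.eigenvalues hN i := by
  obtain ⟨V, hV, hV'⟩ := exists_submodule_le_eigenvalues hS hN i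
  obtain ⟨x, hxV, hxW, hx0⟩ := exists_mem_mem_ne_zero (U := V) (W := W) (by omega)
  have hx : 0 < ‖x‖ ^ 2 := by positivity
  exact le_of_mul_le_mul_right ((h x hxW).trans (hV' x hxV)) hx

theorem eigenvalues_le_of_submodule (hS : S.IsSymmetric) (hN : finrank ℝ G = N) (i : Fin N)
    {W : Submodule ℝ G} (hW : N ≤ finrank ℝ W + i) {c : ℝ}
    (h : ∀ x ∈ W, inner ℝ (S x) x ≤ c * ‖x‖ ^ 2) : hS.eigenvalues hN i ≤ c := by
  obtain ⟨V, hV, hV'⟩ := exists_submodule_eigenvalues_le hS hN i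
  obtain ⟨x, hxV, hxW, hx0⟩ := exists_mem_mem_ne_zero (U := V) (W := W) (by omega)
  have hx : 0 < ‖x‖ ^ 2 := by positivity
  exact le_of_mul_le_mul_right ((hV' x hxV).trans (h x hxW)) hx

theorem eigenvalues_mono {S' : G →ₗ[ℝ] G} (hS : S.IsSymmetric) (hS' : S'.IsSymmetric)
    (hN : finrank ℝ G = N) (h : ∀ x, inner ℝ (S x) x ≤ inner ℝ (S' x) x) (i : Fin N) :
    hS.eigenvalues hN i ≤ hS'.eigenvalues hN i := by
  obtain ⟨V, hV, hV'⟩ := exists_submodule_eigenvalues_le hS hN i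
  exact le_eigenvalues_of_submodule hS' hN i (W := V) (by omega)
    fun x hx => (hV' x hx).trans (h x)

/-- Negation reverses the decreasing order. Keeping `S'` as a variable with an equation allows
`dilation (-A)`, which equals `-dilation A` only propositionally. -/
theorem eigenvalues_rev (hS : S.IsSymmetric) {S' : G →ₗ[ℝ] G} (hS' : S'.IsSymmetric)
    (hSS : S' = -S) (hN : finrank ℝ G = N) (i : Fin N) :
    hS.eigenvalues hN i.rev = -hS'.eigenvalues hN i := by
  subst hSS
  have hi : (i.rev : ℕ) + i + 1 = N := by rw [Fin.val_rev]; omega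
  apply le_antisymm
  · obtain ⟨V, hV, hV'⟩ := exists_submodule_eigenvalues_le hS' hN i
    refine eigenvalues_le_of_submodule hS hN i.rev (W := V) (by omega) fun x hx => ?_
    have := hV' x hx
    simp only [LinearMap.neg_apply, inner_neg_left] at this
    linarith
  · obtain ⟨V, hV, hV'⟩ := exists_submodule_le_eigenvalues hS' hN i
    refine le_eigenvalues_of_submodule hS hN i.rev (W := V) (by omega) fun x hx => ?_
    have := hV' x hx
    simp only [LinearMap.neg_apply, inner_neg_left] at this
    linarith

end MinMax

/-! ### Min-max and Weyl inequalities for singular values -/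

section SingularValues

variable {E F : Type*} [NormedAddCommGroup E] [InnerProductSpace ℝ E] [FiniteDimensional ℝ E]
  [NormedAddCommGroup F] [InnerProductSpace ℝ F] [FiniteDimensional ℝ F]

theorem inner_adjoint_comp_self (A : E →ₗ[ℝ] F) (x : E) :
    inner ℝ ((A.adjoint ∘ₗ A) x) x = ‖A x‖ ^ 2 := by
  rw [LinearMap.comp_apply, LinearMap.adjoint_inner_left, real_inner_self_eq_norm_sq]

theorem exists_submodule_le_singularValues (A : E →ₗ[ℝ] F) (i : ℕ) :
    ∃ W : Submodule ℝ E, finrank ℝ E ≤ finrank ℝ W + i ∧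
      ∀ x ∈ W, ‖A x‖ ≤ A.singularValues i * ‖x‖ := by
  by_cases hi : i < finrank ℝ E
  · obtain ⟨W, hW, h⟩ := exists_submodule_le_eigenvalues A.isSymmetric_adjoint_comp_self rfl ⟨i, hi⟩
    refine ⟨W, hW.ge, fun x hx => ?_⟩
    have := h x hx
    rw [← A.sq_singularValues_fin rfl, inner_adjoint_comp_self, ← mul_pow] at this
    exact le_of_sq_le_sq this (mul_nonneg (A.singularValues_nonneg i) (norm_nonneg _))
  -- Beyond the dimension of `E` the singular values are zero by convention, and the zero subspace
  -- is large enough.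
  · refine ⟨⊥, by omega, fun x hx => ?_⟩
    rw [(Submodule.mem_bot ℝ).1 hx]
    simp

theorem singularValues_le_of_submodule (A : E →ₗ[ℝ] F) (i : ℕ) {W : Submodule ℝ E}
    (hW : finrank ℝ E ≤ finrank ℝ W + i) {c : ℝ} (hc : 0 ≤ c) (h : ∀ x ∈ W, ‖A x‖ ≤ c * ‖x‖) :
    A.singularValues i ≤ c := by
  by_cases hi : i < finrank ℝ E
  · refine le_of_sq_le_sq ?_ hc
    rw [A.sq_singularValues_of_lt rfl hi]
    refine eigenvalues_le_of_submodule _ rfl ⟨i, hi⟩ hW fun x hx => ?_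
    rw [inner_adjoint_comp_self, ← mul_pow]
    exact pow_le_pow_left₀ (norm_nonneg _) (h x hx) 2
  · rwa [A.singularValues_of_finrank_le (not_lt.1 hi)]

theorem singularValues_mono {A B : E →ₗ[ℝ] F} (h : ∀ x, ‖A x‖ ≤ ‖B x‖) (i : ℕ) :
    A.singularValues i ≤ B.singularValues i := by
  obtain ⟨W, hW, hW'⟩ := exists_submodule_le_singularValues B i
  exact singularValues_le_of_submodule A i hW (B.singularValues_nonneg i)
    fun x hx => (h x).trans (hW' x hx)

/-- Weyl's inequality for a perturbation of rank at most `k`. -/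
theorem singularValues_add_le {A B : E →ₗ[ℝ] F} {k : ℕ}
    (h : finrank ℝ (LinearMap.range (A - B)) ≤ k) (i : ℕ) :
    A.singularValues (i + k) ≤ B.singularValues i := by
  obtain ⟨W, hW, hW'⟩ := exists_submodule_le_singularValues B i
  have h1 := Submodule.finrank_sup_add_finrank_inf_eq W (LinearMap.ker (A - B))
  have h2 := Submodule.finrank_le (W ⊔ LinearMap.ker (A - B))
  have h3 := (A - B).finrank_range_add_finrank_ker
  refine singularValues_le_of_submodule A (i + k) (W := W ⊓ LinearMap.ker (A - B)) (by omega)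
    (B.singularValues_nonneg i) fun x hx => ?_
  have : A x = B x := by
    have := LinearMap.mem_ker.1 hx.2
    rwa [LinearMap.sub_apply, sub_eq_zero] at this
  rw [this]
  exact hW' x hx.1

theorem singularValues_eq_zero_of_min_le (A : E →ₗ[ℝ] F) {i : ℕ}
    (hi : min (finrank ℝ F) (finrank ℝ E) ≤ i) : A.singularValues i = 0 := by
  rw [A.singularValues_eq_zero_iff_le_finrank_range]
  exact (le_min (Submodule.finrank_le _) (LinearMap.finrank_range_le A)).trans hi

theorem singularValues_neg (A : E →ₗ[ℝ] F) (i : ℕ) :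
    (-A).singularValues i = A.singularValues i :=
  le_antisymm (singularValues_mono (fun x => by simp) i) (singularValues_mono (fun x => by simp) i)

/-- A basis of right singular vectors. -/
theorem exists_rightSingularBasis (A : E →ₗ[ℝ] F) :
    ∃ v : OrthonormalBasis (Fin (finrank ℝ E)) ℝ E, ∀ i j,
      inner ℝ (A (v i)) (A (v j)) = if i = j then A.singularValues i ^ 2 else 0 := by
  refine ⟨A.isSymmetric_adjoint_comp_self.eigenvectorBasis rfl, fun i j => ?_⟩
  rw [← LinearMap.adjoint_inner_left, ← LinearMap.comp_apply,
    LinearMap.IsSymmetric.apply_eigenvectorBasis, A.sq_singularValues_fin rfl, inner_smul_left,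
    orthonormal_iff_ite.1 (OrthonormalBasis.orthonormal _)]
  simp

end SingularValues

theorem finrank_le_finrank_comap_add {G E : Type*} [AddCommGroup G] [Module ℝ G]
    [FiniteDimensional ℝ G] [AddCommGroup E] [Module ℝ E] [FiniteDimensional ℝ E]
    (f : G →ₗ[ℝ] E) (W : Submodule ℝ E) :
    finrank ℝ G ≤ finrank ℝ (W.comap f) + (finrank ℝ E - finrank ℝ W) := by
  have h1 := (W.mkQ ∘ₗ f).finrank_range_add_finrank_ker
  rw [LinearMap.ker_comp, Submodule.ker_mkQ] at h1
  have h2 := Submodule.finrank_le (LinearMap.range (W.mkQ ∘ₗ f))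
  have h3 := W.finrank_quotient_add_finrank
  omega

/-! ### Self-adjoint dilation and rank-one perturbations -/

section Dilation

variable {E F : Type*} [NormedAddCommGroup E] [InnerProductSpace ℝ E] [FiniteDimensional ℝ E]
  [NormedAddCommGroup F] [InnerProductSpace ℝ F] [FiniteDimensional ℝ F]

/-- The self-adjoint dilation `(x, y) ↦ (A† y, A x)` of a linear map `A`. -/
noncomputable def dilation (A : E →ₗ[ℝ] F) : WithLp 2 (E × F) →ₗ[ℝ] WithLp 2 (E × F) :=
  (WithLp.linearEquiv 2 ℝ (E × F)).symm.toLinearMap ∘ₗ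
    ((A.adjoint ∘ₗ LinearMap.snd ℝ E F).prod (A ∘ₗ LinearMap.fst ℝ E F)) ∘ₗ
      (WithLp.linearEquiv 2 ℝ (E × F)).toLinearMap

theorem dilation_apply (A : E →ₗ[ℝ] F) (z : WithLp 2 (E × F)) :
    dilation A z = WithLp.toLp 2 (A.adjoint z.snd, A z.fst) := rfl

theorem dilation_isSymmetric (A : E →ₗ[ℝ] F) : (dilation A).IsSymmetric := by
  intro z z'
  simp only [dilation_apply, WithLp.prod_inner_apply, LinearMap.adjoint_inner_left]
  rw [LinearMap.adjoint_inner_right, add_comm]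
  rfl

theorem inner_dilation (A : E →ₗ[ℝ] F) (z : WithLp 2 (E × F)) :
    inner ℝ (dilation A z) z = 2 * inner ℝ (A z.fst) z.snd := by
  simp only [dilation_apply, WithLp.prod_inner_apply, LinearMap.adjoint_inner_left]
  rw [real_inner_comm]
  simp only [WithLp.ofLp_fst, WithLp.ofLp_snd]
  ring

theorem dilation_neg (A : E →ₗ[ℝ] F) : dilation (-A) = -dilation A := by
  refine LinearMap.ext fun z => ?_
  rw [LinearMap.neg_apply, dilation_apply, dilation_apply, ← WithLp.toLp_neg]
  simp

variable {N : ℕ}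

/-- If `‖A x‖ ≤ σ_i ‖x‖` on `W` of codimension at most `i`, then on W × F, of no larger codimension,
2⟨Ax, y⟩ ≤ 2σ_i‖x‖‖y‖ ≤ σ_i(‖x‖² + ‖y‖²). -/
theorem eigenvalues_dilation_le (A : E →ₗ[ℝ] F) (hN : finrank ℝ (WithLp 2 (E × F)) = N)
    (i : Fin N) : (dilation_isSymmetric A).eigenvalues hN i ≤ A.singularValues i := by
  obtain ⟨W, hW, h⟩ := exists_submodule_le_singularValues A i
  refine eigenvalues_le_of_submodule _ hN i
    (W := W.comap (LinearMap.fst ℝ E F ∘ₗ (WithLp.linearEquiv 2 ℝ (E × F)).toLinearMap)) ?_ ?_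
  · have := finrank_le_finrank_comap_add
      (LinearMap.fst ℝ E F ∘ₗ (WithLp.linearEquiv 2 ℝ (E × F)).toLinearMap) W
    omega
  · intro z hz
    have h1 : ‖A z.fst‖ ≤ A.singularValues i * ‖z.fst‖ := h _ hz
    rw [inner_dilation, WithLp.prod_norm_sq_eq_of_L2]
    have h2 := real_inner_le_norm (A z.fst) z.snd
    have h3 := mul_le_mul_of_nonneg_right h1 (norm_nonneg z.snd)
    have h4 := mul_nonneg (A.singularValues_nonneg i) (sq_nonneg (‖z.fst‖ - ‖z.snd‖))
    nlinarith

theorem le_eigenvalues_dilation (A : E →ₗ[ℝ] F) (hN : finrank ℝ (WithLp 2 (E × F)) = N)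
    (i : Fin N) (hi : (i : ℕ) < finrank ℝ E) :
    A.singularValues i ≤ (dilation_isSymmetric A).eigenvalues hN i := by
  rcases (A.singularValues_nonneg i).eq_or_lt with h0 | h0
  · rw [← h0]
    -- For σ_i = 0 no left singular vector A v / σ is available; instead the form vanishes on E × 0,
    -- whose dimension exceeds `i`.
    refine le_eigenvalues_of_submodule _ hN i (W := LinearMap.range
      ((WithLp.linearEquiv 2 ℝ (E × F)).symm.toLinearMap ∘ₗ LinearMap.inl ℝ E F)) ?_ ?_
    · rw [LinearMap.finrank_range_of_inj]
      · exact hi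
      · exact (WithLp.linearEquiv 2 ℝ (E × F)).symm.injective.comp LinearMap.inl_injective
    · rintro _ ⟨x, rfl⟩
      rw [inner_dilation]
      simp
  · obtain ⟨v, hv⟩ := exists_rightSingularBasis A
    have hpos : ∀ j : {j : Fin (finrank ℝ E) // (j : ℕ) ≤ i}, 0 < A.singularValues j :=
      fun j => h0.trans_le (A.singularValues_antitone j.2)
    -- Pairing right and left singular vectors gives orthonormal eigenvectors of the dilation for
    -- the eigenvalues σ_0, …, σ_i.
    let f : {j : Fin (finrank ℝ E) // (j : ℕ) ≤ i} → WithLp 2 (E × F) := fun j =>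
      (√2)⁻¹ • WithLp.toLp 2 (v j, (A.singularValues j)⁻¹ • A (v j))
    have hf : Orthonormal ℝ f := by
      classical
      rw [orthonormal_iff_ite]
      intro j k
      simp only [f, inner_smul_left, inner_smul_right, WithLp.prod_inner_apply, hv,
        orthonormal_iff_ite.1 v.orthonormal]
      have h2 : (√2)⁻¹ * ((√2)⁻¹ * (2 : ℝ)) = 1 := by
        rw [← mul_assoc, ← mul_inv, Real.mul_self_sqrt (by norm_num)]; norm_num
      by_cases hjk : j = k
      · subst hjk
        have := (hpos j).ne'
        simp only [if_true, RCLike.conj_to_real]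
        rw [← h2]
        congr 2
        field_simp
        norm_num
      · have : (j : Fin (finrank ℝ E)) ≠ k := fun h => hjk (Subtype.ext h)
        simp [hjk, this]
    have hS : ∀ j, dilation A (f j) = A.singularValues j • f j := by
      intro j
      have hadj : A.adjoint (A (v j)) = (A.singularValues j) ^ 2 • v j := by
        refine InnerProductSpace.ext_inner_right_basis v.toBasis fun k => ?_
        rw [OrthonormalBasis.coe_toBasis, LinearMap.adjoint_inner_left, hv, inner_smul_left,
          orthonormal_iff_ite.1 v.orthonormal]
        simp
      have := (hpos j).ne'
      simp only [f, map_smul, dilation_apply]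
      rw [smul_comm]
      congr 1
      rw [← WithLp.toLp_smul, Prod.smul_mk]
      simp only [WithLp.toLp_fst, WithLp.toLp_snd, map_smul, hadj, smul_smul]
      congr 3
      · field_simp
      · rw [mul_inv_cancel₀ this, one_smul]
    refine le_eigenvalues_of_submodule _ hN i (W := Submodule.span ℝ (Set.range f)) ?_
      fun z hz => le_inner_of_mem_span hf hS (fun j => A.singularValues_antitone j.2) hz
    rw [finrank_span_eq_card hf.linearIndependent, Fintype.card_subtype]
    have : (Finset.univ.filter fun j : Fin (finrank ℝ E) => (j : ℕ) ≤ i)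
      = Finset.Iic ⟨i, hi⟩ := by ext; simp [Fin.le_def]
    rw [this, Fin.card_Iic]
    simp

theorem eigenvalues_dilation (A : E →ₗ[ℝ] F) (hN : finrank ℝ (WithLp 2 (E × F)) = N)
    (i : Fin N) (hi : (i : ℕ) < finrank ℝ E) :
    (dilation_isSymmetric A).eigenvalues hN i = A.singularValues i :=
  le_antisymm (eigenvalues_dilation_le A hN i) (le_eigenvalues_dilation A hN i hi)

theorem eigenvalues_dilation_rev (A : E →ₗ[ℝ] F) (hN : finrank ℝ (WithLp 2 (E × F)) = N)
    (i : Fin N) (hi : (i : ℕ) < finrank ℝ E) :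
    (dilation_isSymmetric A).eigenvalues hN i.rev = -A.singularValues i := by
  rw [eigenvalues_rev (dilation_isSymmetric A) (dilation_isSymmetric (-A)) (dilation_neg A),
    eigenvalues_dilation _ hN i hi, singularValues_neg]

theorem two_mul_sum_abs_singularValues_sub_le (A B : E →ₗ[ℝ] F)
    (hN : finrank ℝ (WithLp 2 (E × F)) = N) :
    2 * ∑ i ∈ Finset.range (min (finrank ℝ F) (finrank ℝ E)),
      |A.singularValues i - B.singularValues i| ≤
    ∑ i, |(dilation_isSymmetric A).eigenvalues hN i - (dilation_isSymmetric B).eigenvalues hN i| := by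
  set K := min (finrank ℝ F) (finrank ℝ E) with hK
  have hKN : K + K ≤ N := by
    have : N = finrank ℝ E + finrank ℝ F := by
      rw [← hN, (WithLp.linearEquiv 2 ℝ (E × F)).finrank_eq, Module.finrank_prod]
    omega
  -- The top K and bottom K eigenvalues are σ_i and -σ_i, so each block contributes one copy of the
  -- sum; the blocks are disjoint because 2K ≤ dim E + dim F.
  let e : Fin K ⊕ Fin K → Fin N :=
    Sum.elim (fun j => Fin.castLE (by omega) j) (fun j => (Fin.castLE (by omega) j).rev)
  have he : Function.Injective e := by
    rintro (a | a) (b | b) h <;>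
      simp only [e, Sum.elim_inl, Sum.elim_inr, Fin.ext_iff, Fin.val_rev, Fin.val_castLE] at h <;>
      first
        | (congr 1; ext; omega)
        | omega
  calc _ = ∑ j : Fin K ⊕ Fin K, |(dilation_isSymmetric A).eigenvalues hN (e j) -
        (dilation_isSymmetric B).eigenvalues hN (e j)| := by
        rw [Fintype.sum_sum_type, Finset.sum_range, two_mul]
        congr 1 <;> refine Finset.sum_congr rfl fun j _ => ?_
        · simp only [e, Sum.elim_inl]
          rw [eigenvalues_dilation, eigenvalues_dilation] <;> simp only [Fin.val_castLE] <;> omega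
        · simp only [e, Sum.elim_inr]
          rw [eigenvalues_dilation_rev, eigenvalues_dilation_rev]
          · rw [neg_sub_neg, abs_sub_comm]; rfl
          all_goals simp only [Fin.val_castLE]; omega
    _ ≤ _ := by
        refine (Finset.sum_map Finset.univ ⟨e, he⟩ (fun i =>
          |(dilation_isSymmetric A).eigenvalues hN i -
            (dilation_isSymmetric B).eigenvalues hN i|)).symm.le.trans ?_
        exact Finset.sum_le_univ_sum_of_nonneg fun _ => abs_nonneg _

/-- Symmetric operators with a common upper bound. -/
theorem sum_abs_eigenvalues_sub_le {G : Type*} [NormedAddCommGroup G] [InnerProductSpace ℝ G]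
    [FiniteDimensional ℝ G] {S T : G →ₗ[ℝ] G} (hS : S.IsSymmetric) (hT : T.IsSymmetric)
    (hN : finrank ℝ G = N) (y z : G)
    (h : S + (rankOne ℝ y y : G →L[ℝ] G).toLinearMap = T + (rankOne ℝ z z : G →L[ℝ] G).toLinearMap) :
    ∑ i, |hS.eigenvalues hN i - hT.eigenvalues hN i| ≤ ‖y‖ ^ 2 + ‖z‖ ^ 2 := by
  have hR : ∀ y : G, (rankOne ℝ y y : G →L[ℝ] G).toLinearMap.IsSymmetric := by
    intro y a b
    simp [inner_smul_left, inner_smul_right, mul_comm, real_inner_comm]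
  have hpos : ∀ y a : G, 0 ≤ inner ℝ ((rankOne ℝ y y : G →L[ℝ] G).toLinearMap a) a := by
    intro y a
    simpa [inner_smul_left] using mul_self_nonneg _
  -- The common majorant M satisfies |s_i - t_i| ≤ (m_i - s_i) + (m_i - t_i), and the two sums on
  -- the right are trace differences, ‖y‖² and ‖z‖².
  have hM : (S + (rankOne ℝ y y : G →L[ℝ] G).toLinearMap).IsSymmetric := hS.add (hR y)
  have hSM : ∀ i, hS.eigenvalues hN i ≤ hM.eigenvalues hN i := fun i =>
    eigenvalues_mono hS hM hN (fun x => by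
      rw [LinearMap.add_apply, inner_add_left]; linarith [hpos y x]) i
  have hTM : ∀ i, hT.eigenvalues hN i ≤ hM.eigenvalues hN i := fun i =>
    eigenvalues_mono hT hM hN (fun x => by
      rw [h, LinearMap.add_apply, inner_add_left]; linarith [hpos z x]) i
  have tS := hS.trace_eq_sum_eigenvalues hN
  have tT := hT.trace_eq_sum_eigenvalues hN
  have tM := hM.trace_eq_sum_eigenvalues hN
  have tM' := congrArg (LinearMap.trace ℝ G) h
  rw [map_add, trace_rankOne, real_inner_self_eq_norm_sq] at tM
  simp only [map_add, trace_rankOne, real_inner_self_eq_norm_sq] at tM'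
  simp only [RCLike.ofReal_real_eq_id, id_eq] at tS tT tM
  calc _ ≤ ∑ i, ((hM.eigenvalues hN i - hS.eigenvalues hN i) +
        (hM.eigenvalues hN i - hT.eigenvalues hN i)) := by
        refine Finset.sum_le_sum fun i _ => abs_le.2 ⟨?_, ?_⟩ <;> linarith [hSM i, hTM i]
    _ = _ := by
        rw [Finset.sum_add_distrib, Finset.sum_sub_distrib, Finset.sum_sub_distrib]
        linarith

/-- The trace-norm perturbation bound for singular values under a rank-one perturbation. -/
theorem sum_abs_singularValues_sub_le_of_rankOne {A B : E →ₗ[ℝ] F} {v : E} {w : F} (hv : ‖v‖ = 1)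
    (h : ∀ x, A x = B x + inner ℝ v x • w) :
    ∑ i ∈ Finset.range (min (finrank ℝ F) (finrank ℝ E)),
      |A.singularValues i - B.singularValues i| ≤ ‖w‖ := by
  rcases eq_or_ne w 0 with rfl | hw
  · have : A = B := by ext x; simp [h]
    simp [this]
  have hw' : 0 < ‖w‖ := norm_pos_iff.2 hw
  -- The dilations differ by yy* - zz*: the diagonal blocks cancel and the off-diagonal ones double.
  -- This value of `s` makes the result exactly right and gives ‖y‖² = ‖z‖² = ‖w‖.
  set s := √(‖w‖ / 2)
  have hs2 : s ^ 2 = ‖w‖ / 2 := Real.sq_sqrt (by positivity)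
  have hw1 : ‖‖w‖⁻¹ • w‖ = 1 := by
    rw [norm_smul, norm_inv, norm_norm, inv_mul_cancel₀ hw'.ne']
  let y : WithLp 2 (E × F) := s • WithLp.toLp 2 (v, ‖w‖⁻¹ • w)
  let z : WithLp 2 (E × F) := s • WithLp.toLp 2 (v, -(‖w‖⁻¹ • w))
  have hy : ‖y‖ ^ 2 = ‖w‖ := by
    simp only [y, norm_smul, mul_pow, WithLp.prod_norm_sq_eq_of_L2]
    simp [hs2, hv, hw1]
    ring
  have hz : ‖z‖ ^ 2 = ‖w‖ := by
    simp only [z, norm_smul, mul_pow, WithLp.prod_norm_sq_eq_of_L2]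
    simp [hs2, hv, hw1]
    ring
  have hadj : ∀ b, A.adjoint b = B.adjoint b + inner ℝ w b • v := by
    intro b
    refine ext_inner_right ℝ fun x => ?_
    rw [LinearMap.adjoint_inner_left, h, inner_add_left, inner_add_right, inner_smul_left,
      inner_smul_right, LinearMap.adjoint_inner_left, real_inner_comm b w]
    simp [mul_comm]
  have key : dilation A + (rankOne ℝ z z : _ →L[ℝ] WithLp 2 (E × F)).toLinearMap =
      dilation B + (rankOne ℝ y y : _ →L[ℝ] WithLp 2 (E × F)).toLinearMap := by
    refine LinearMap.ext fun a => ?_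
    have hza : inner ℝ z a = s * (inner ℝ v a.fst - ‖w‖⁻¹ * inner ℝ w a.snd) := by
      simp only [z, inner_smul_left, WithLp.prod_inner_apply, inner_neg_left]
      simp [sub_eq_add_neg]
    have hya : inner ℝ y a = s * (inner ℝ v a.fst + ‖w‖⁻¹ * inner ℝ w a.snd) := by
      simp only [y, inner_smul_left, WithLp.prod_inner_apply]
      simp
    simp only [LinearMap.add_apply, ContinuousLinearMap.coe_coe, rankOne_apply, hza, hya,
      dilation_apply]
    simp only [y, z, ← WithLp.toLp_smul, ← WithLp.toLp_add, Prod.smul_mk, Prod.mk_add_mk, h, hadj]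
    congr 2
    · match_scalars <;> field_simp
      all_goals
        simp only [hs2]
        ring
    · match_scalars <;> field_simp
      all_goals
        simp only [hs2]
        ring
  have h1 := sum_abs_eigenvalues_sub_le (dilation_isSymmetric A) (dilation_isSymmetric B) rfl z y key
  have h2 := two_mul_sum_abs_singularValues_sub_le A B rfl
  rw [hy, hz] at h1
  linarith

end Dilation

/-! ### Concave Mirsky inequality -/

section ConcaveMirsky

/-- Both `x` and `s + d` are convex combinations of the outer points `x + d` and `s`, with the
weights interchanged; adding the two concavity inequalities gives the claim. -/
theorem rpow_add_rpow_le {p : ℝ} (hp0 : 0 < p) (hp1 : p ≤ 1) {x s d : ℝ} (hs : 0 ≤ s) (hsx : s ≤ x)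
    (hd : 0 ≤ d) : (x + d) ^ p + s ^ p ≤ x ^ p + (s + d) ^ p := by
  rcases hd.eq_or_lt with rfl | hd
  · simp
  have hc := Real.concaveOn_rpow hp0.le hp1
  have hD : 0 < x + d - s := by linarith
  have hxd : x + d ∈ Set.Ici (0 : ℝ) := by simp only [Set.mem_Ici]; linarith
  have hs' : s ∈ Set.Ici (0 : ℝ) := hs
  have hα : 0 ≤ (x - s) / (x + d - s) := div_nonneg (sub_nonneg.2 hsx) hD.le
  have hδ : 0 ≤ d / (x + d - s) := div_nonneg hd.le hD.le
  have e3 : (x - s) / (x + d - s) + d / (x + d - s) = 1 := by field_simp; ring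
  have h1 := hc.2 hxd hs' hα hδ e3
  have h2 := hc.2 hxd hs' hδ hα ((add_comm _ _).trans e3)
  simp only [smul_eq_mul] at h1 h2
  have e1 : (x - s) / (x + d - s) * (x + d) + d / (x + d - s) * s = x := by field_simp; ring
  have e2 : d / (x + d - s) * (x + d) + (x - s) / (x + d - s) * s = s + d := by field_simp; ring
  rw [e1] at h1
  rw [e2] at h2
  calc (x + d) ^ p + s ^ p = ((x - s) / (x + d - s) + d / (x + d - s)) * (x + d) ^ p +
        ((x - s) / (x + d - s) + d / (x + d - s)) * s ^ p := by rw [e3, one_mul, one_mul]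
    _ ≤ _ := by linarith

/-- Power sums over interlacing sequences. -/
theorem sum_abs_rpow_sub_le_of_interlacing {p : ℝ} (hp0 : 0 < p) (hp1 : p ≤ 1) (k : ℕ) :
    ∀ a b : ℕ → ℝ, (∀ i, 0 ≤ a i) → (∀ i, 0 ≤ b i) → Antitone a → Antitone b →
      (∀ i, a (i + 1) ≤ b i) → (∀ i, b (i + 1) ≤ a i) →
      ∑ i ∈ Finset.range k, |a i - b i| ≤ max (a 0) (b 0) ∧
      ∑ i ∈ Finset.range k, |a i ^ p - b i ^ p| ≤ (∑ i ∈ Finset.range k, |a i - b i|) ^ p := by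
  induction k with
  | zero =>
    intro a b ha hb _ _ _ _
    simp [ha 0, Real.zero_rpow hp0.ne']
  | succ k ih =>
    intro a b ha hb hanti hbnti hab hba
    -- Induction on the shifted sequences. The first conclusion is carried along because, with
    -- interlacing, it puts the remaining sum `s` below both `a 0` and `b 0`, as concavity requires.
    obtain ⟨h1, h2⟩ := ih (fun i => a (i + 1)) (fun i => b (i + 1)) (fun i => ha _) (fun i => hb _)
      (fun i j hij => hanti (by omega)) (fun i j hij => hbnti (by omega))
      (fun i => hab _) (fun i => hba _)
    rw [Finset.sum_range_succ', Finset.sum_range_succ']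
    set s := ∑ i ∈ Finset.range k, |a (i + 1) - b (i + 1)|
    have hs0 : 0 ≤ s := Finset.sum_nonneg fun _ _ => abs_nonneg _
    have hsa : s ≤ a 0 := h1.trans (max_le (hanti (by omega)) (hba 0))
    have hsb : s ≤ b 0 := h1.trans (max_le (hab 0) (hbnti (by omega)))
    rcases le_total (a 0) (b 0) with h | h
    · have hp : a 0 ^ p ≤ b 0 ^ p := Real.rpow_le_rpow (ha 0) h hp0.le
      have := rpow_add_rpow_le hp0 hp1 hs0 hsa (sub_nonneg.2 h)
      rw [add_sub_cancel] at this
      rw [abs_sub_comm, abs_of_nonneg (sub_nonneg.2 h), abs_sub_comm (a 0 ^ p),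
        abs_of_nonneg (sub_nonneg.2 hp), max_eq_right h]
      constructor <;> linarith
    · have hp : b 0 ^ p ≤ a 0 ^ p := Real.rpow_le_rpow (hb 0) h hp0.le
      have := rpow_add_rpow_le hp0 hp1 hs0 hsb (sub_nonneg.2 h)
      rw [add_sub_cancel] at this
      rw [abs_of_nonneg (sub_nonneg.2 h), abs_of_nonneg (sub_nonneg.2 hp), max_eq_left h]
      constructor <;> linarith

variable {E F : Type*} [NormedAddCommGroup E] [InnerProductSpace ℝ E] [FiniteDimensional ℝ E]
  [NormedAddCommGroup F] [InnerProductSpace ℝ F] [FiniteDimensional ℝ F]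

theorem sum_abs_rpow_singularValues_sub_le_of_rankOne {p : ℝ} (hp0 : 0 < p) (hp1 : p ≤ 1)
    {A B : E →ₗ[ℝ] F} {v : E} {w : F} (hv : ‖v‖ = 1) (h : ∀ x, A x = B x + inner ℝ v x • w) :
    ∑ i ∈ Finset.range (min (finrank ℝ F) (finrank ℝ E)),
      |A.singularValues i ^ p - B.singularValues i ^ p| ≤ ‖w‖ ^ p := by
  have hrank : finrank ℝ (LinearMap.range (A - B)) ≤ 1 := by
    refine (Submodule.finrank_mono (t := Submodule.span ℝ {w}) ?_).trans
      ((finrank_span_le_card ({w} : Set F)).trans (by simp))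
    rintro _ ⟨x, rfl⟩
    rw [LinearMap.sub_apply, h, add_sub_cancel_left]
    exact Submodule.smul_mem _ _ (Submodule.mem_span_singleton_self w)
  have hrank' : finrank ℝ (LinearMap.range (B - A)) ≤ 1 := by
    rwa [← neg_sub, LinearMap.range_neg]
  refine (sum_abs_rpow_sub_le_of_interlacing hp0 hp1 _ _ _ A.singularValues_nonneg
    B.singularValues_nonneg A.singularValues_antitone B.singularValues_antitone
    (singularValues_add_le hrank) (singularValues_add_le hrank')).2.trans ?_
  exact Real.rpow_le_rpow (Finset.sum_nonneg fun _ _ => abs_nonneg _)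
    (sum_abs_singularValues_sub_le_of_rankOne hv h) hp0.le

/-- The concave Mirsky inequality for the power function. -/
theorem sum_abs_rpow_singularValues_sub_le {p : ℝ} (hp0 : 0 < p) (hp1 : p ≤ 1) (A B : E →ₗ[ℝ] F) :
    ∑ i ∈ Finset.range (min (finrank ℝ F) (finrank ℝ E)),
      |A.singularValues i ^ p - B.singularValues i ^ p| ≤
    ∑ i ∈ Finset.range (min (finrank ℝ F) (finrank ℝ E)), (A - B).singularValues i ^ p := by
  obtain ⟨v, hv⟩ := exists_rightSingularBasis (A - B)
  have hnorm : ∀ j, ‖(A - B) (v j)‖ = (A - B).singularValues j := fun j => by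
    have := hv j j
    rw [real_inner_self_eq_norm_sq, if_pos rfl] at this
    exact (pow_left_inj₀ (norm_nonneg _) ((A - B).singularValues_nonneg j) two_ne_zero).1 this
  -- Adding the piece along `v j` costs at most ‖(A - B) v_j‖^p = σ_j(A - B)^p; the triangle
  -- inequality sums the costs.
  have key : ∀ s : Finset (Fin (finrank ℝ E)),
      ∑ i ∈ Finset.range (min (finrank ℝ F) (finrank ℝ E)),
        |(B + ∑ j ∈ s, (rankOne ℝ ((A - B) (v j)) (v j) : E →L[ℝ] F).toLinearMap).singularValues i ^ p
          - B.singularValues i ^ p| ≤ ∑ j ∈ s, (A - B).singularValues j ^ p := by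
    intro s
    induction s using Finset.induction_on with
    | empty => simp
    | insert j s hj ih =>
      rw [Finset.sum_insert hj, Finset.sum_insert hj]
      have h1 := sum_abs_rpow_singularValues_sub_le_of_rankOne hp0 hp1
        (A := B + ((rankOne ℝ ((A - B) (v j)) (v j) : E →L[ℝ] F).toLinearMap +
          ∑ j ∈ s, (rankOne ℝ ((A - B) (v j)) (v j) : E →L[ℝ] F).toLinearMap))
        (B := B + ∑ j ∈ s, (rankOne ℝ ((A - B) (v j)) (v j) : E →L[ℝ] F).toLinearMap)
        (v := v j) (w := (A - B) (v j)) (v.orthonormal.1 j) (fun x => by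
          simp only [LinearMap.add_apply, ContinuousLinearMap.coe_coe, rankOne_apply]
          abel)
      rw [hnorm] at h1
      refine le_trans ?_ (add_le_add h1 ih)
      rw [← Finset.sum_add_distrib]
      exact Finset.sum_le_sum fun i _ => abs_sub_le _ _ _
  have hA : B + ∑ j, (rankOne ℝ ((A - B) (v j)) (v j) : E →L[ℝ] F).toLinearMap = A := by
    refine (sub_eq_iff_eq_add'.1 ?_).symm
    refine v.toBasis.ext fun i => ?_
    simp only [OrthonormalBasis.coe_toBasis, LinearMap.sum_apply, ContinuousLinearMap.coe_coe,
      rankOne_apply, orthonormal_iff_ite.1 v.orthonormal]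
    simp
  have := key Finset.univ
  rw [hA] at this
  refine this.trans ?_
  rw [← Finset.sum_range (fun j => (A - B).singularValues j ^ p)]
  refine (Finset.sum_subset (Finset.range_mono (min_le_right _ _)) fun i _ hi => ?_).symm.le
  rw [singularValues_eq_zero_of_min_le _ (not_lt.1 fun h => hi (Finset.mem_range.2 h)), Real.zero_rpow hp0.ne']

end ConcaveMirsky

/-! ### Eckart-Young theory for an arbitrary best approximation -/

section EckartYoung

variable {E F : Type*} [NormedAddCommGroup E] [InnerProductSpace ℝ E] [FiniteDimensional ℝ E]
  [NormedAddCommGroup F] [InnerProductSpace ℝ F] [FiniteDimensional ℝ F]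

/-- The squared Hilbert-Schmidt norm. -/
noncomputable def hilbertSchmidtSq (A : E →ₗ[ℝ] F) : ℝ :=
  LinearMap.trace ℝ E (A.adjoint ∘ₗ A)

theorem hilbertSchmidtSq_eq_sum {ι : Type*} [Fintype ι] (A : E →ₗ[ℝ] F)
    (b : OrthonormalBasis ι ℝ E) : hilbertSchmidtSq A = ∑ i, ‖A (b i)‖ ^ 2 := by
  rw [hilbertSchmidtSq, LinearMap.trace_eq_sum_inner _ b]
  exact Finset.sum_congr rfl fun i _ => by rw [real_inner_comm, inner_adjoint_comp_self]

theorem hilbertSchmidtSq_eq_sum_singularValues (A : E →ₗ[ℝ] F) :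
    hilbertSchmidtSq A =
      ∑ i ∈ Finset.range (min (finrank ℝ F) (finrank ℝ E)), A.singularValues i ^ 2 := by
  rw [hilbertSchmidtSq, A.isSymmetric_adjoint_comp_self.trace_eq_sum_eigenvalues rfl]
  simp only [← A.sq_singularValues_fin rfl, RCLike.ofReal_real_eq_id, id_eq]
  rw [← Finset.sum_range (fun j => A.singularValues j ^ 2)]
  refine (Finset.sum_subset (Finset.range_mono (min_le_right _ _)) fun i _ hi => ?_).symm
  rw [singularValues_eq_zero_of_min_le _ (not_lt.1 fun h => hi (Finset.mem_range.2 h))]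
  simp

/-- The truncated singular value decomposition as a competitor for low-rank approximation. -/
theorem exists_rank_le_hilbertSchmidtSq_sub (r : ℕ) (A : E →ₗ[ℝ] F) :
    ∃ T : E →ₗ[ℝ] F, finrank ℝ (LinearMap.range T) ≤ r ∧
      hilbertSchmidtSq (A - T) =
        ∑ i ∈ Finset.range (finrank ℝ E), if i < r then 0 else A.singularValues i ^ 2 := by
  obtain ⟨v, hv⟩ := exists_rightSingularBasis A
  classical
  refine ⟨v.toBasis.constr ℝ fun i => if (i : ℕ) < r then A (v i) else 0, ?_, ?_⟩
  · rw [Basis.constr_range]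
    let s : Finset F := (Finset.univ.filter fun i : Fin (finrank ℝ E) => (i : ℕ) < r).image
      fun i => A (v i)
    have hs : s.card ≤ r := by
      refine Finset.card_image_le.trans ?_
      refine (Finset.card_le_card_of_injOn (t := Finset.range r) Fin.val
        (fun i hi => by simpa using hi) Fin.val_injective.injOn).trans (Finset.card_range r).le
    refine le_trans (Submodule.finrank_mono ?_) ((finrank_span_finset_le_card s).trans hs)
    rw [Submodule.span_le]
    rintro _ ⟨i, rfl⟩
    by_cases hi : (i : ℕ) < r
    · simp only [hi, if_true]
      exact Submodule.subset_span (by simpa [s] using ⟨i, hi, rfl⟩)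
    · simp only [hi, if_false]
      exact Submodule.zero_mem _
  · rw [hilbertSchmidtSq_eq_sum _ v, Finset.sum_range]
    refine Finset.sum_congr rfl fun i _ => ?_
    have : v.toBasis.constr ℝ (fun i => if (i : ℕ) < r then A (v i) else 0) (v i) =
        if (i : ℕ) < r then A (v i) else 0 := by
      conv_lhs => rw [← v.coe_toBasis]
      rw [Basis.constr_basis]
      simp
    rw [LinearMap.sub_apply, this]
    by_cases hi : (i : ℕ) < r
    · simp [hi]
    · simp only [hi, if_false, sub_zero]
      rw [← real_inner_self_eq_norm_sq, hv, if_pos rfl]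

theorem eq_zero_of_forall_quadratic_nonneg {a b : ℝ} (h : ∀ ε : ℝ, 0 ≤ ε ^ 2 * a - 2 * ε * b) :
    b = 0 := by
  by_contra hb
  have hb2 : 0 < b ^ 2 := by positivity
  have ha : 0 < |a| + 1 := by positivity
  have h1 := h (b / (|a| + 1))
  have h2 : (b / (|a| + 1)) ^ 2 * a - 2 * (b / (|a| + 1)) * b =
      b ^ 2 / (|a| + 1) ^ 2 * (a - 2 * (|a| + 1)) := by field_simp
  rw [h2] at h1
  have h3 : 0 < b ^ 2 / (|a| + 1) ^ 2 := by positivity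
  have h4 := nonneg_of_mul_nonneg_right h1 h3
  linarith [le_abs_self a, abs_nonneg a]

variable {r : ℕ} {A Z : E →ₗ[ℝ] F}

/-- First-order optimality of a best low-rank approximation. -/
theorem adjoint_comp_sub_eq_zero_of_best (hZ : finrank ℝ (LinearMap.range Z) ≤ r)
    (hbest : ∀ W : E →ₗ[ℝ] F, finrank ℝ (LinearMap.range W) ≤ r →
      hilbertSchmidtSq (A - Z) ≤ hilbertSchmidtSq (A - W)) :
    Z.adjoint ∘ₗ (A - Z) = 0 := by
  let b := stdOrthonormalBasis ℝ E
  set S := Z.adjoint ∘ₗ (A - Z) with hS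
  have h1 : ∑ i, ‖S (b i)‖ ^ 2 = 0 := by
    refine eq_zero_of_forall_quadratic_nonneg (a := ∑ i, ‖Z (S (b i))‖ ^ 2) fun ε => ?_
    -- This variation keeps the range inside that of `Z`, hence is admissible, and the linear term
    -- in ε of its error is -2ε times the squared Hilbert-Schmidt norm of `S`.
    have h2 := hbest (Z + ε • (Z ∘ₗ S)) (by
      refine (Submodule.finrank_mono ?_).trans hZ
      rintro _ ⟨x, rfl⟩
      exact ⟨x + ε • S x, by simp⟩)
    rw [hilbertSchmidtSq_eq_sum _ b, hilbertSchmidtSq_eq_sum _ b] at h2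
    have h3 : ∀ i, ‖(A - (Z + ε • (Z ∘ₗ S))) (b i)‖ ^ 2 =
        ‖(A - Z) (b i)‖ ^ 2 + (ε ^ 2 * ‖Z (S (b i))‖ ^ 2 - 2 * ε * ‖S (b i)‖ ^ 2) := by
      intro i
      have : (A - (Z + ε • (Z ∘ₗ S))) (b i) = (A - Z) (b i) - ε • Z (S (b i)) := by
        simp [sub_sub]
      rw [this, norm_sub_sq_real, inner_smul_right, ← LinearMap.adjoint_inner_left,
        ← LinearMap.comp_apply, ← hS, real_inner_self_eq_norm_sq, norm_smul, mul_pow,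
        Real.norm_eq_abs, sq_abs]
      ring
    rw [Finset.sum_congr rfl fun i _ => h3 i, Finset.sum_add_distrib, Finset.sum_sub_distrib,
      ← Finset.mul_sum, ← Finset.mul_sum] at h2
    linarith
  refine b.toBasis.ext fun i => ?_
  have := (Finset.sum_eq_zero_iff_of_nonneg fun i _ => sq_nonneg ‖S (b i)‖).1 h1 i
    (Finset.mem_univ i)
  simpa using this

theorem norm_sq_eq_of_best (hZ : finrank ℝ (LinearMap.range Z) ≤ r)
    (hbest : ∀ W : E →ₗ[ℝ] F, finrank ℝ (LinearMap.range W) ≤ r →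
      hilbertSchmidtSq (A - Z) ≤ hilbertSchmidtSq (A - W)) (x : E) :
    ‖A x‖ ^ 2 = ‖Z x‖ ^ 2 + ‖(A - Z) x‖ ^ 2 := by
  have h := LinearMap.congr_fun (adjoint_comp_sub_eq_zero_of_best hZ hbest) x
  have h' : inner ℝ (Z x) ((A - Z) x) = 0 := by
    rw [← LinearMap.adjoint_inner_right, ← LinearMap.comp_apply, h]
    simp
  have : A x = Z x + (A - Z) x := by simp
  rw [this, norm_add_sq_real, h']
  ring

/-- Turns an optimal total error into individual singular values: termwise domination with the
reverse inequality of sums leaves no slack. -/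
theorem eq_of_sum_sq_le {K : ℕ} {f g : ℕ → ℝ} (hg : ∀ i, 0 ≤ g i)
    (h : ∀ i, g i ≤ f i) (hs : ∑ i ∈ Finset.range K, f i ^ 2 ≤ ∑ i ∈ Finset.range K, g i ^ 2)
    {i : ℕ} (hi : i < K) : f i = g i := by
  have h1 : ∀ i ∈ Finset.range K, g i ^ 2 ≤ f i ^ 2 := fun i _ => pow_le_pow_left₀ (hg i) (h i) 2
  have h2 := (Finset.sum_eq_sum_iff_of_le h1).1 (le_antisymm (Finset.sum_le_sum h1) hs) i
    (Finset.mem_range.2 hi)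
  exact ((pow_left_inj₀ (hg i) ((hg i).trans (h i)) two_ne_zero).1 h2).symm

theorem hilbertSchmidtSq_sub_le_of_best
    (hbest : ∀ W : E →ₗ[ℝ] F, finrank ℝ (LinearMap.range W) ≤ r →
      hilbertSchmidtSq (A - Z) ≤ hilbertSchmidtSq (A - W)) :
    hilbertSchmidtSq (A - Z) ≤
      ∑ i ∈ Finset.range (min (finrank ℝ F) (finrank ℝ E)),
        if i < r then 0 else A.singularValues i ^ 2 := by
  obtain ⟨T, hT, hT'⟩ := exists_rank_le_hilbertSchmidtSq_sub r A
  refine (hbest T hT).trans (hT'.trans ?_).le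
  refine (Finset.sum_subset (Finset.range_mono (min_le_right _ _)) fun i _ hi => ?_).symm
  rw [singularValues_eq_zero_of_min_le _ (not_lt.1 fun h => hi (Finset.mem_range.2 h))]
  simp

/-- The singular values of the residual of a best approximation of rank at most `r`. -/
theorem singularValues_sub_of_best (hZ : finrank ℝ (LinearMap.range Z) ≤ r)
    (hbest : ∀ W : E →ₗ[ℝ] F, finrank ℝ (LinearMap.range W) ≤ r →
      hilbertSchmidtSq (A - Z) ≤ hilbertSchmidtSq (A - W)) (i : ℕ) :
    (A - Z).singularValues i = A.singularValues (i + r) := by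
  -- Weyl's inequality applies since A - (A - Z) = Z has rank at most `r`; optimality against the
  -- truncated decomposition forces equality.
  have hle : ∀ i, A.singularValues (i + r) ≤ (A - Z).singularValues i :=
    singularValues_add_le (by rwa [sub_sub_cancel])
  by_cases hi : i < min (finrank ℝ F) (finrank ℝ E)
  · refine eq_of_sum_sq_le (f := (A - Z).singularValues) (g := fun i => A.singularValues (i + r))
      (fun i => A.singularValues_nonneg _) hle ?_ hi
    rw [← hilbertSchmidtSq_eq_sum_singularValues]
    refine (hilbertSchmidtSq_sub_le_of_best hbest).trans ?_
    set K := min (finrank ℝ F) (finrank ℝ E)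
    calc _ ≤ ∑ i ∈ Finset.range (r + K), if i < r then 0 else A.singularValues i ^ 2 :=
          Finset.sum_le_sum_of_subset_of_nonneg (Finset.range_mono (by omega))
            fun i _ _ => by split_ifs <;> positivity
      _ = _ := by
          rw [Finset.sum_range_add, Finset.sum_eq_zero, zero_add]
          · exact Finset.sum_congr rfl fun i _ => by rw [if_neg (by omega), add_comm]
          · intro i hi
            rw [if_pos (Finset.mem_range.1 hi)]
  · rw [singularValues_eq_zero_of_min_le _ (not_lt.1 hi),
      singularValues_eq_zero_of_min_le _ (by omega)]

/-- The singular values of a best approximation of rank at most `r`. -/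
theorem singularValues_of_best (hZ : finrank ℝ (LinearMap.range Z) ≤ r)
    (hbest : ∀ W : E →ₗ[ℝ] F, finrank ℝ (LinearMap.range W) ≤ r →
      hilbertSchmidtSq (A - Z) ≤ hilbertSchmidtSq (A - W)) (i : ℕ) :
    Z.singularValues i = if i < r then A.singularValues i else 0 := by
  have hpyth := norm_sq_eq_of_best hZ hbest
  -- Pythagoras gives ‖Zx‖ ≤ ‖Ax‖ pointwise; summed over a basis, it also makes the total energies
  -- match below.
  have hle : ∀ i, Z.singularValues i ≤ A.singularValues i := singularValues_mono fun x =>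
    le_of_sq_le_sq (by linarith [hpyth x, sq_nonneg ‖(A - Z) x‖]) (norm_nonneg _)
  have hzero : ∀ i, r ≤ i → Z.singularValues i = 0 := fun i hi =>
    Z.singularValues_eq_zero_iff_le_finrank_range.2 (hZ.trans hi)
  by_cases hi : i < min (finrank ℝ F) (finrank ℝ E)
  · refine (eq_of_sum_sq_le (f := fun i => if i < r then A.singularValues i else 0)
      Z.singularValues_nonneg (fun i => ?_) ?_ hi).symm
    · split_ifs with h
      · exact hle i
      · exact (hzero i (not_lt.1 h)).le
    · have h1 : hilbertSchmidtSq A = hilbertSchmidtSq Z + hilbertSchmidtSq (A - Z) := by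
        let b := stdOrthonormalBasis ℝ E
        rw [hilbertSchmidtSq_eq_sum _ b, hilbertSchmidtSq_eq_sum _ b, hilbertSchmidtSq_eq_sum _ b,
          ← Finset.sum_add_distrib]
        exact Finset.sum_congr rfl fun i _ => hpyth _
      have h2 := hilbertSchmidtSq_sub_le_of_best hbest
      rw [hilbertSchmidtSq_eq_sum_singularValues, hilbertSchmidtSq_eq_sum_singularValues] at h1
      have h3 : ∑ i ∈ Finset.range (min (finrank ℝ F) (finrank ℝ E)), A.singularValues i ^ 2 =
          ∑ i ∈ Finset.range (min (finrank ℝ F) (finrank ℝ E)),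
            (if i < r then A.singularValues i else 0) ^ 2 +
          ∑ i ∈ Finset.range (min (finrank ℝ F) (finrank ℝ E)),
            if i < r then 0 else A.singularValues i ^ 2 := by
        rw [← Finset.sum_add_distrib]
        exact Finset.sum_congr rfl fun i _ => by split_ifs <;> simp
      linarith
  · rw [singularValues_eq_zero_of_min_le _ (not_lt.1 hi),
      singularValues_eq_zero_of_min_le _ (not_lt.1 hi), ite_self]

end EckartYoung

/-! ### Hölder and Stechkin estimates for sequences -/

section SequenceNorms

theorem lNorm_nonneg {k : ℕ} (q : ℝ≥0∞) (x : Fin k → ℝ) : 0 ≤ lNorm q x := by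
  unfold lNorm
  rcases q.trichotomy with rfl | rfl | h
  · rw [PiLp.norm_eq_card]; positivity
  · rw [PiLp.norm_eq_ciSup]; exact Real.iSup_nonneg fun _ => norm_nonneg _
  · rw [PiLp.norm_eq_sum h]; positivity

theorem lNorm_eq_sum {k : ℕ} {q : ℝ≥0∞} (hq : 0 < q.toReal) {x : ℕ → ℝ} (hx : ∀ i, 0 ≤ x i) :
    lNorm q (fun j : Fin k => x j) = (∑ i ∈ Finset.range k, x i ^ q.toReal) ^ (1 / q.toReal) := by
  unfold lNorm
  rw [PiLp.norm_eq_sum hq, Finset.sum_range]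
  simp only [Real.norm_eq_abs, abs_of_nonneg (hx _)]

theorem le_lNorm_top {k : ℕ} (x : Fin k → ℝ) (j : Fin k) : |x j| ≤ lNorm ∞ x := by
  unfold lNorm
  rw [PiLp.norm_eq_ciSup]
  exact le_ciSup (f := fun i => ‖x i‖) (Set.finite_range _).bddAbove j

theorem lNorm_top_le {k : ℕ} (x : Fin k → ℝ) {c : ℝ} (hc : 0 ≤ c) (h : ∀ j, |x j| ≤ c) :
    lNorm ∞ x ≤ c := by
  unfold lNorm
  rw [PiLp.norm_eq_ciSup]
  exact Real.iSup_le h hc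

variable {p : ℝ} {r K : ℕ} {s : ℕ → ℝ}

/-- The first `r` entries of a sequence, followed by zeros. -/
def truncate (r : ℕ) (s : ℕ → ℝ) (i : ℕ) : ℝ := if i < r then s i else 0

theorem truncate_nonneg (hs : ∀ i, 0 ≤ s i) (i : ℕ) : 0 ≤ truncate r s i := by
  unfold truncate
  split_ifs
  · exact hs i
  · exact le_rfl

theorem sum_truncate_rpow {τ : ℝ} (hτ : 0 < τ) :
    ∑ i ∈ Finset.range K, truncate r s i ^ τ = ∑ i ∈ Finset.range (min r K), s i ^ τ := by
  have h : ∀ i, truncate r s i ^ τ = if i < r then s i ^ τ else 0 := fun i => by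
    unfold truncate
    split_ifs
    · rfl
    · exact Real.zero_rpow hτ.ne'
  rw [Finset.sum_congr rfl fun i _ => h i, ← Finset.sum_filter]
  congr 1
  ext i
  simp [and_comm]

theorem rankFactor_pos (hr : 0 < r) (p : ℝ) (t : ℝ≥0∞) : 0 < rankFactor r p t :=
  Real.rpow_pos_of_pos (by exact_mod_cast hr) _

theorem rankFactor_top (hp0 : 0 < p) : rankFactor r p ∞ = r := by
  simp [rankFactor, hp0.ne']

theorem rankFactor_of_ne_top (hp0 : 0 < p) {t : ℝ≥0∞} :
    rankFactor r p t = (r : ℝ) ^ (1 - p / t.toReal) := by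
  rw [rankFactor, ENNReal.toReal_inv]
  congr 1
  field_simp

/-- Hölder's inequality for the head of a sequence. -/
theorem sum_head_rpow_le (hr : 0 < r) (hp0 : 0 < p) {t : ℝ≥0∞} (hpt : ENNReal.ofReal p ≤ t)
    (hs : ∀ i, 0 ≤ s i) :
    ∑ i ∈ Finset.range (min r K), s i ^ p ≤
      rankFactor r p t * lNorm t (fun j : Fin K => truncate r s j) ^ p := by
  rcases eq_or_ne t ∞ with rfl | ht
  · rw [rankFactor_top hp0]
    have h : ∀ i ∈ Finset.range (min r K),
        s i ^ p ≤ lNorm ∞ (fun j : Fin K => truncate r s j) ^ p := fun i hi => by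
      rw [Finset.mem_range, lt_min_iff] at hi
      refine Real.rpow_le_rpow (hs i) ?_ hp0.le
      refine le_trans ?_ (le_lNorm_top _ ⟨i, hi.2⟩)
      simpa [truncate, hi.1] using le_abs_self _
    refine (Finset.sum_le_sum h).trans ?_
    rw [Finset.sum_const, Finset.card_range, nsmul_eq_mul]
    refine mul_le_mul_of_nonneg_right ?_ (Real.rpow_nonneg (lNorm_nonneg _ _) _)
    exact_mod_cast min_le_left _ _
  · have hpτ : p ≤ t.toReal := (ENNReal.ofReal_le_iff_le_toReal ht).1 hpt
    have hτ : 0 < t.toReal := hp0.trans_le hpτ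
    rw [rankFactor_of_ne_top hp0, lNorm_eq_sum hτ (truncate_nonneg hs), sum_truncate_rpow hτ]
    set τ := t.toReal
    have hθ : 1 ≤ τ / p := (one_le_div hp0).2 hpτ
    have hr1 : (1 : ℝ) ≤ r := by exact_mod_cast hr
    -- Power mean inequality with exponent τ/p ≥ 1 for the numbers s_i^p, then the (p/τ)-th power.
    have h1 := Real.rpow_sum_le_const_mul_sum_rpow (Finset.range (min r K)) (fun i => s i ^ p) hθ
    have h2 : ∀ i, |s i ^ p| = s i ^ p := fun i => abs_of_nonneg (Real.rpow_nonneg (hs i) _)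
    have h3 : ∀ i, (s i ^ p) ^ (τ / p) = s i ^ τ := fun i => by
      rw [← Real.rpow_mul (hs i), mul_div_cancel₀ _ hp0.ne']
    simp only [h2, h3, Finset.card_range] at h1
    set U := ∑ i ∈ Finset.range (min r K), s i ^ p
    set V := ∑ i ∈ Finset.range (min r K), s i ^ τ
    have hU : 0 ≤ U := Finset.sum_nonneg fun i _ => Real.rpow_nonneg (hs i) _
    have hV : 0 ≤ V := Finset.sum_nonneg fun i _ => Real.rpow_nonneg (hs i) _
    have h4 : U ^ (τ / p) ≤ (r : ℝ) ^ (τ / p - 1) * V :=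
      h1.trans (mul_le_mul_of_nonneg_right (Real.rpow_le_rpow (by positivity)
        (by exact_mod_cast min_le_left _ _) (by linarith)) hV)
    have h5 := Real.rpow_le_rpow (Real.rpow_nonneg hU _) h4 (z := p / τ) (by positivity)
    rw [← Real.rpow_mul hU, div_mul_div_cancel₀ hp0.ne', div_self hτ.ne', Real.rpow_one,
      Real.mul_rpow (by positivity) hV, ← Real.rpow_mul (by positivity)] at h5
    refine h5.trans (le_of_eq ?_)
    rw [← Real.rpow_mul hV]
    congr 2 <;> field_simp

/-- Stechkin's estimate for the tail of a decreasing sequence. -/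
theorem lNorm_rpow_le_head_add (hr : 0 < r) (hp0 : 0 < p) {t : ℝ≥0∞} (hpt : ENNReal.ofReal p ≤ t)
    (hs : ∀ i, 0 ≤ s i) (hanti : Antitone s) :
    lNorm t (fun j : Fin K => s j) ^ p ≤
      lNorm t (fun j : Fin K => truncate r s j) ^ p +
        (∑ i ∈ Finset.range K, s i ^ p) / rankFactor r p t := by
  have hM : 0 ≤ ∑ i ∈ Finset.range K, s i ^ p :=
    Finset.sum_nonneg fun i _ => Real.rpow_nonneg (hs i) _
  have hrpos : (0 : ℝ) < r := by exact_mod_cast hr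
  rcases eq_or_ne t ∞ with rfl | ht
  · refine le_trans ?_ (le_add_of_nonneg_right (div_nonneg hM (rankFactor_pos hr p ∞).le))
    refine Real.rpow_le_rpow (lNorm_nonneg _ _) ?_ hp0.le
    refine lNorm_top_le _ (lNorm_nonneg _ _) fun j => ?_
    refine le_trans ?_ (le_lNorm_top _ ⟨0, j.pos⟩)
    simpa [truncate, hr, abs_of_nonneg (hs _)] using hanti (Nat.zero_le j)
  · have hpτ : p ≤ t.toReal := (ENNReal.ofReal_le_iff_le_toReal ht).1 hpt
    have hτ : 0 < t.toReal := hp0.trans_le hpτ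
    rw [rankFactor_of_ne_top hp0, lNorm_eq_sum hτ (truncate_nonneg hs), sum_truncate_rpow hτ,
      lNorm_eq_sum hτ hs]
    set τ := t.toReal
    set M := ∑ i ∈ Finset.range K, s i ^ p
    have hθ : 0 ≤ τ / p - 1 := sub_nonneg.2 ((one_le_div hp0).2 hpτ)
    have hnn : ∀ (e : ℝ) (f : Finset ℕ), 0 ≤ ∑ i ∈ f, s i ^ e := fun e f =>
      Finset.sum_nonneg fun i _ => Real.rpow_nonneg (hs i) _
    have hpow : ∀ f : Finset ℕ, ((∑ i ∈ f, s i ^ τ) ^ (1 / τ)) ^ p =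
        (∑ i ∈ f, s i ^ τ) ^ (p / τ) := fun f => by
      rw [← Real.rpow_mul (hnn _ _)]
      congr 1
      ring
    rw [hpow, hpow]
    have hsplit : ∑ i ∈ Finset.range K, s i ^ τ =
        ∑ i ∈ Finset.range (min r K), s i ^ τ + ∑ i ∈ Finset.Ico (min r K) K, s i ^ τ :=
      (Finset.sum_range_add_sum_Ico _ (min_le_right _ _)).symm
    rw [hsplit]
    refine (Real.rpow_add_le_add_rpow (hnn _ _) (hnn _ _) (by positivity)
      ((div_le_one hτ).2 hpτ)).trans (add_le_add_right ?_ _)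
    -- A tail entry is at most each of the first `r` entries. The average is over the full sum `M`,
    -- head included.
    have hentry : ∀ i ∈ Finset.Ico (min r K) K, s i ^ p ≤ M / r := fun i hi => by
      rw [Finset.mem_Ico] at hi
      rw [le_div_iff₀ hrpos, mul_comm, ← nsmul_eq_mul]
      calc r • s i ^ p = ∑ j ∈ Finset.range r, s i ^ p := by simp
        _ ≤ ∑ j ∈ Finset.range r, s j ^ p := Finset.sum_le_sum fun j hj =>
            Real.rpow_le_rpow (hs i) (hanti (by have := Finset.mem_range.1 hj; omega)) hp0.le
        _ ≤ M := Finset.sum_le_sum_of_subset_of_nonneg (Finset.range_mono (by omega))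
            fun j _ _ => Real.rpow_nonneg (hs j) _
    have hMr : 0 ≤ M / r := div_nonneg hM hrpos.le
    have htail : ∑ i ∈ Finset.Ico (min r K) K, s i ^ τ ≤ (M / r) ^ (τ / p - 1) * M := by
      calc _ ≤ ∑ i ∈ Finset.Ico (min r K) K, (M / r) ^ (τ / p - 1) * s i ^ p :=
            Finset.sum_le_sum fun i hi => by
              have h0 := Real.rpow_nonneg (hs i) p
              have : s i ^ τ = (s i ^ p) ^ (τ / p - 1) * s i ^ p := by
                rw [← Real.rpow_mul (hs i)]
                rcases (hs i).eq_or_lt with h | h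
                · rw [← h, Real.zero_rpow hτ.ne', Real.zero_rpow hp0.ne', mul_zero]
                · rw [← Real.rpow_add h]
                  congr 1
                  field_simp
                  ring
              rw [this]
              exact mul_le_mul_of_nonneg_right (Real.rpow_le_rpow h0 (hentry i hi) hθ) h0
        _ ≤ _ := by
            rw [← Finset.mul_sum]
            refine mul_le_mul_of_nonneg_left ?_ (Real.rpow_nonneg hMr _)
            refine Finset.sum_le_sum_of_subset_of_nonneg (fun i hi => ?_)
              fun j _ _ => Real.rpow_nonneg (hs j) _
            exact Finset.mem_range.2 (Finset.mem_Ico.1 hi).2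
    refine (Real.rpow_le_rpow (hnn _ _) htail (by positivity)).trans (le_of_eq ?_)
    rw [Real.mul_rpow (Real.rpow_nonneg hMr _) hM, ← Real.rpow_mul hMr]
    have e1 : (τ / p - 1) * (p / τ) = 1 - p / τ := by field_simp
    rw [e1, Real.div_rpow hM hrpos.le, div_mul_eq_mul_div]
    congr 1
    rcases hM.eq_or_lt with h | h
    · rw [← h, Real.zero_rpow (x := p / τ) (by positivity), mul_zero]
    · rw [← Real.rpow_add h]
      simp

end SequenceNorms

/-! ### Matrices and the recovery estimate -/

section Matrices

variable {m n : ℕ}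

theorem frobeniusSq_eq_hilbertSchmidtSq (X : Matrix (Fin m) (Fin n) ℝ) :
    frobeniusSq X = hilbertSchmidtSq (Matrix.toEuclideanLin X) := by
  rw [hilbertSchmidtSq_eq_sum _ (EuclideanSpace.basisFun (Fin n) ℝ), frobeniusSq, Finset.sum_comm]
  refine Finset.sum_congr rfl fun j _ => ?_
  rw [EuclideanSpace.real_norm_sq_eq]
  refine Finset.sum_congr rfl fun i _ => ?_
  simp [Matrix.toLpLin_apply]

theorem finrank_range_toEuclideanLin (X : Matrix (Fin m) (Fin n) ℝ) :
    finrank ℝ (LinearMap.range (Matrix.toEuclideanLin X)) = X.rank := by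
  rw [Matrix.rank_eq_finrank_range_toLin X (EuclideanSpace.basisFun (Fin m) ℝ).toBasis
    (EuclideanSpace.basisFun (Fin n) ℝ).toBasis]
  rfl

variable {r : ℕ}

theorem maxPart_best (r : ℕ) (X : Matrix (Fin m) (Fin n) ℝ) :
    finrank ℝ (LinearMap.range (Matrix.toEuclideanLin (maxPart r X))) ≤ r ∧
    ∀ W : EuclideanSpace ℝ (Fin n) →ₗ[ℝ] EuclideanSpace ℝ (Fin m),
      finrank ℝ (LinearMap.range W) ≤ r →
      hilbertSchmidtSq (Matrix.toEuclideanLin X - Matrix.toEuclideanLin (maxPart r X)) ≤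
        hilbertSchmidtSq (Matrix.toEuclideanLin X - W) := by
  obtain ⟨h1, h2⟩ := isBestRankApprox_maxPart r X
  refine ⟨by rwa [finrank_range_toEuclideanLin], fun W hW => ?_⟩
  obtain ⟨W, rfl⟩ := Matrix.toEuclideanLin.surjective W
  rw [finrank_range_toEuclideanLin] at hW
  simpa only [frobeniusSq_eq_hilbertSchmidtSq, map_sub] using h2 W hW

theorem singularVector_maxPart (X : Matrix (Fin m) (Fin n) ℝ) :
    singularVector (maxPart r X) = fun j : Fin (min m n) =>
      truncate r (Matrix.toEuclideanLin X).singularValues j :=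
  funext fun j => singularValues_of_best (maxPart_best r X).1 (maxPart_best r X).2 j

theorem schattenNorm_ofReal_rpow {p : ℝ} (hp0 : 0 < p) (X : Matrix (Fin m) (Fin n) ℝ) :
    schattenNorm (ENNReal.ofReal p) X ^ p =
      ∑ i ∈ Finset.range (min m n), (Matrix.toEuclideanLin X).singularValues i ^ p := by
  have hq : (ENNReal.ofReal p).toReal = p := ENNReal.toReal_ofReal hp0.le
  have := lNorm_eq_sum (k := min m n) (q := ENNReal.ofReal p) (by rwa [hq])
    (Matrix.toEuclideanLin X).singularValues_nonneg
  rw [hq] at this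
  unfold schattenNorm singularVector
  rw [this, ← Real.rpow_mul (Finset.sum_nonneg fun i _ =>
    Real.rpow_nonneg (LinearMap.singularValues_nonneg _ _) _), one_div_mul_cancel hp0.ne',
    Real.rpow_one]

/-- The residual has the singular values of `X` shifted by `r`. Starting at `min r (min m n)` makes
the index set complementary to that of the head even when `r` exceeds `min m n`. -/
theorem schattenNorm_tailPart_rpow {p : ℝ} (hp0 : 0 < p) (X : Matrix (Fin m) (Fin n) ℝ) :
    schattenNorm (ENNReal.ofReal p) (tailPart r X) ^ p =
      ∑ i ∈ Finset.Ico (min r (min m n)) (min m n),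
        (Matrix.toEuclideanLin X).singularValues i ^ p := by
  rw [schattenNorm_ofReal_rpow hp0, tailPart, map_sub]
  simp only [singularValues_sub_of_best (maxPart_best r X).1 (maxPart_best r X).2]
  have h0 : ∀ i, min m n ≤ i → (Matrix.toEuclideanLin X).singularValues i ^ p = 0 := fun i hi => by
    rw [singularValues_eq_zero_of_min_le _ (by simpa using hi), Real.zero_rpow hp0.ne']
  set f : ℕ → ℝ := fun i => (Matrix.toEuclideanLin X).singularValues i ^ p
  have h1 : ∑ i ∈ Finset.range (min m n), f (i + r) = ∑ i ∈ Finset.Ico r (min m n + r), f i := by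
    rw [Finset.sum_Ico_eq_sum_range, Nat.add_sub_cancel]
    exact Finset.sum_congr rfl fun i _ => by rw [add_comm]
  refine h1.trans (Finset.sum_subset (fun i hi => ?_) fun i hi hi' => h0 i ?_).symm
  · simp only [Finset.mem_Ico] at hi ⊢
    omega
  · simp only [Finset.mem_Ico] at hi hi'
    omega

/-- The stable recovery estimate from the null space inequality at `Y - X` alone. -/
theorem schattenNorm_sub_rpow_le {p : ℝ} (hr : 0 < r) (hp0 : 0 < p) (hp1 : p ≤ 1) {t : ℝ≥0∞}
    (hpt : ENNReal.ofReal p ≤ t) {D β a : ℝ} (hD : 0 < D) (hβ0 : 0 < β) (hβ1 : β < 1)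
    (ha : 0 ≤ a) (X Y : Matrix (Fin m) (Fin n) ℝ)
    (h : schattenNorm t (maxPart r (Y - X)) ^ p ≤ D * a +
      β * (schattenNorm (ENNReal.ofReal p) (tailPart r (Y - X)) ^ p / rankFactor r p t)) :
    schattenNorm t (Y - X) ^ p ≤
      (1 + β) ^ 2 / (1 - β) * (1 / rankFactor r p t) *
        (schattenNorm (ENNReal.ofReal p) Y ^ p - schattenNorm (ENNReal.ofReal p) X ^ p
          + 2 * schattenNorm (ENNReal.ofReal p) (tailPart r X) ^ p)
      + (3 + β) * D / (1 - β) * a := by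
  set R := rankFactor r p t with hR
  have hRpos : 0 < R := rankFactor_pos hr p t
  have hmir := sum_abs_rpow_singularValues_sub_le hp0 hp1
    (Matrix.toEuclideanLin X) (Matrix.toEuclideanLin (X - Y))
  have hneg : ∀ i, (Matrix.toEuclideanLin (X - Y)).singularValues i =
      (Matrix.toEuclideanLin (Y - X)).singularValues i := fun i => by
    rw [← neg_sub, map_neg, singularValues_neg]
  have hXY : Matrix.toEuclideanLin X - Matrix.toEuclideanLin (X - Y) = Matrix.toEuclideanLin Y := by
    rw [← map_sub, sub_sub_cancel]
  simp only [hneg, hXY, finrank_euclideanSpace, Fintype.card_fin] at hmir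
  rw [← schattenNorm_ofReal_rpow hp0] at hmir
  have hhead := sum_head_rpow_le (K := min m n) hr hp0 hpt
    (Matrix.toEuclideanLin (Y - X)).singularValues_nonneg
  have hst := lNorm_rpow_le_head_add (K := min m n) hr hp0 hpt
    (Matrix.toEuclideanLin (Y - X)).singularValues_nonneg
    (Matrix.toEuclideanLin (Y - X)).singularValues_antitone
  rw [← singularVector_maxPart, ← hR] at hhead hst
  change _ ≤ R * schattenNorm t (maxPart r (Y - X)) ^ p at hhead
  change schattenNorm t (Y - X) ^ p ≤ schattenNorm t (maxPart r (Y - X)) ^ p + _ at hst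
  rw [schattenNorm_tailPart_rpow hp0] at h ⊢
  rw [schattenNorm_ofReal_rpow hp0 X]
  set x := (Matrix.toEuclideanLin X).singularValues
  set z := (Matrix.toEuclideanLin (Y - X)).singularValues
  set K := min m n
  rw [← Finset.sum_range_add_sum_Ico (fun i => z i ^ p) (min_le_right r K)] at hst
  rw [← Finset.sum_range_add_sum_Ico (fun i => x i ^ p) (min_le_right r K)]
  rw [← Finset.sum_range_add_sum_Ico _ (min_le_right r K)] at hmir
  have h1 : ∑ i ∈ Finset.range (min r K), x i ^ p - ∑ i ∈ Finset.range (min r K), z i ^ p ≤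
      ∑ i ∈ Finset.range (min r K), |x i ^ p - z i ^ p| := by
    rw [← Finset.sum_sub_distrib]
    exact Finset.sum_le_sum fun i _ => le_abs_self _
  have h2 : ∑ i ∈ Finset.Ico (min r K) K, z i ^ p - ∑ i ∈ Finset.Ico (min r K) K, x i ^ p ≤
      ∑ i ∈ Finset.Ico (min r K) K, |x i ^ p - z i ^ p| := by
    rw [← Finset.sum_sub_distrib]
    exact Finset.sum_le_sum fun i _ => by rw [abs_sub_comm]; exact le_abs_self _
  have hu : 0 ≤ ∑ i ∈ Finset.Ico (min r K) K, z i ^ p :=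
    Finset.sum_nonneg fun i _ => Real.rpow_nonneg (LinearMap.singularValues_nonneg _ _) _
  generalize schattenNorm t (Y - X) ^ p = T at *
  generalize schattenNorm t (maxPart r (Y - X)) ^ p = H at *
  generalize schattenNorm (ENNReal.ofReal p) Y ^ p = y at *
  generalize ∑ i ∈ Finset.Ico (min r K) K, z i ^ p = u at *
  generalize ∑ i ∈ Finset.Ico (min r K) K, x i ^ p = xt at *
  generalize ∑ i ∈ Finset.range (min r K), z i ^ p = w at *
  generalize ∑ i ∈ Finset.range (min r K), x i ^ p = xh at *
  have hβ : 0 < 1 - β := by linarith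
  set e := y - (xh + xt) + 2 * xt with he
  -- Mirsky, with signs chosen on each block: (xh - w) + (u - xt) ≤ y.
  have hue : u ≤ w + e := by linarith
  have hw : w ≤ R * (D * a) + β * u := by
    have := hhead.trans (mul_le_mul_of_nonneg_left h hRpos.le)
    have e2 : R * (D * a + β * (u / R)) = R * (D * a) + β * u := by field_simp
    linarith
  have hu2 : u / R ≤ (D * a + e / R) / (1 - β) := by
    rw [div_le_div_iff₀ hRpos hβ]
    have e2 : (D * a + e / R) * R = R * (D * a) + e := by field_simp
    linarith
  -- Stechkin gives T ≤ H + (w + u)/R; the null space property bounds `H` directly and `w` through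
  -- Hölder, whence the factor 2.
  have hT : T ≤ 2 * (D * a) + (1 + 2 * β) * (u / R) := by
    have h3 : (w + u) / R ≤ D * a + (1 + β) * (u / R) := by
      rw [div_le_iff₀ hRpos]
      have e2 : (D * a + (1 + β) * (u / R)) * R = R * (D * a) + (1 + β) * u := by field_simp
      linarith
    linarith
  have huR : 0 ≤ u / R := div_nonneg hu hRpos.le
  have h4 : T ≤ 2 * (D * a) + (1 + β) ^ 2 * ((D * a + e / R) / (1 - β)) := by
    have := mul_le_mul_of_nonneg_left hu2 (sq_nonneg (1 + β))
    nlinarith [mul_nonneg (sq_nonneg β) huR]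
  -- The argument yields 2 + (1 + β)²/(1 - β) = (3 + β²)/(1 - β) in front of `D * a`; relaxing β² to
  -- β leaves the nonnegative last term.
  have h5 : (1 + β) ^ 2 / (1 - β) * (1 / R) * e + (3 + β) * D / (1 - β) * a =
      2 * (D * a) + (1 + β) ^ 2 * ((D * a + e / R) / (1 - β)) + β * (1 - β) / (1 - β) * (D * a) := by
    field_simp
    ring
  rw [h5]
  have : 0 ≤ β * (1 - β) / (1 - β) * (D * a) := by positivity
  linarith

end Matrices

end RankNSP

theorem mainTheorem4 (m n L r : ℕ) (hr : 0 < r)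
    (p : ℝ) (hp0 : 0 < p) (hp1 : p ≤ 1) (t : ℝ≥0∞) (hpt : ENNReal.ofReal p ≤ t)
    (A : Matrix (Fin m) (Fin n) ℝ →ₗ[ℝ] (Fin L → ℝ)) :
    (∀ q : ℝ, 0 < q → ∀ D β : ℝ, 0 < D → 0 < β → β < 1 →
      RankNSP.RobustRankNSPlq A t p q r D β →
      ∀ X Y : Matrix (Fin m) (Fin n) ℝ,
        RankNSP.schattenNorm t (Y - X) ^ p ≤
          (1 + β) ^ 2 / (1 - β) * (1 / RankNSP.rankFactor r p t) *
            (RankNSP.schattenNorm (ENNReal.ofReal p) Y ^ p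
              - RankNSP.schattenNorm (ENNReal.ofReal p) X ^ p
              + 2 * RankNSP.schattenNorm (ENNReal.ofReal p) (RankNSP.tailPart r X) ^ p)
          + (3 + β) * D / (1 - β) *
            RankNSP.lNorm (ENNReal.ofReal q) (A (Y - X)) ^ p) ∧
    (∀ D β : ℝ, 0 < D → 0 < β → β < 1 →
      RankNSP.RobustRankNSPDantzig A t p r D β →
      ∀ X Y : Matrix (Fin m) (Fin n) ℝ,
        RankNSP.schattenNorm t (Y - X) ^ p ≤
          (1 + β) ^ 2 / (1 - β) * (1 / RankNSP.rankFactor r p t) *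
            (RankNSP.schattenNorm (ENNReal.ofReal p) Y ^ p
              - RankNSP.schattenNorm (ENNReal.ofReal p) X ^ p
              + 2 * RankNSP.schattenNorm (ENNReal.ofReal p) (RankNSP.tailPart r X) ^ p)
          + (3 + β) * D / (1 - β) *
            RankNSP.schattenNorm ∞ (RankNSP.adjointMap A (A (Y - X))) ^ p) :=
  -- The measurement term enters only as a nonnegative number, so one estimate serves both bounds.
  ⟨fun _ _ _ _ hD hβ0 hβ1 hA X Y =>
    RankNSP.schattenNorm_sub_rpow_le hr hp0 hp1 hpt hD hβ0 hβ1
      (Real.rpow_nonneg (RankNSP.lNorm_nonneg _ _) _) X Y (hA (Y - X)),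
  fun _ _ hD hβ0 hβ1 hA X Y =>
    RankNSP.schattenNorm_sub_rpow_le hr hp0 hp1 hpt hD hβ0 hβ1
      (Real.rpow_nonneg (RankNSP.lNorm_nonneg _ _) _) X Y (hA (Y - X))⟩
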